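/- A \emph{rectilinear drawing} $\mathcal D$ of a finite simple graph $G$ places the vertices of $G$ at distinct points of the plane in general position (no three on a line) and represents every edge by the segment joining its endpoints, in such a way that no three edges share an interior point. A \emph{crossing} of $\mathcal D$ is a common interior point of two distinct edges. Let $S_k(\mathcal D)$ be the number of edges of $G$ that are involved in at most $k$ crossings of $\mathcal D$, and let $\overline{\max}\, S_k(K_n)$ be the maximum of $S_k(\mathcal D)$ over all rectilinear drawings $\mathcal D$ of the complete graph $K_n$. Theorem. There are absolute constants $c, C > 0$ such that, for all non-negative integers $n$ and $k$ with $1 \le k \le \left(\frac{n-2}{2}\right)^2$, the maximum $\overline{\max}\, S_k(K_n)$ exists and \[ c\, n\sqrt{k} \;\le\; \overline{\max}\, S_k(K_n) \;\le\; C\, n\sqrt{k}. \] -/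

import Mathlib

/-- The Euclidean plane. -/
abbrev Plane : Type := EuclideanSpace ℝ (Fin 2)

/-- The relative interior of the straight-line edge `e` when the vertices are placed by `pos`:
for `e = s(u, v)` it is the open segment from `pos u` to `pos v`. -/
def edgeInterior {V : Type*} (pos : V → Plane) (e : Sym2 V) : Set Plane :=
  Sym2.lift ⟨fun u v => openSegment ℝ (pos u) (pos v), fun u v => openSegment_symm ℝ (pos u) (pos v)⟩ e

/-- A rectilinear drawing of a graph `G`: vertices are distinct points of the plane in general
position, every edge is the segment joining its endpoints, and no three edges share an interior
point. (General position implies that no edge passes through a vertex other than its endpoints, and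
that two distinct edges lie on distinct lines, so that they have at most one common point and are
never tangent.) -/
structure RectilinearDrawing {V : Type*} (G : SimpleGraph V) where
  pos : V → Plane
  pos_injective : Function.Injective pos
  general_position : ∀ u v w : V, u ≠ v → u ≠ w → v ≠ w →
    ¬ Collinear ℝ ({pos u, pos v, pos w} : Set Plane)
  no_triple : ∀ e₁ ∈ G.edgeSet, ∀ e₂ ∈ G.edgeSet, ∀ e₃ ∈ G.edgeSet,
    e₁ ≠ e₂ → e₁ ≠ e₃ → e₂ ≠ e₃ →
    edgeInterior pos e₁ ∩ edgeInterior pos e₂ ∩ edgeInterior pos e₃ = ∅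

namespace RectilinearDrawing

/-- The crossings that the edge `e` is part of: the interior points that `e` shares with another
edge of the drawing. -/
def crossingsOn {V : Type*} {G : SimpleGraph V} (D : RectilinearDrawing G) (e : Sym2 V) :
    Set Plane :=
  {p | p ∈ edgeInterior D.pos e ∧ ∃ f ∈ G.edgeSet, f ≠ e ∧ p ∈ edgeInterior D.pos f}

/-- The `k`-crossing sum `S_k(D)`: the number of edges that are part of at most `k` crossings. -/
noncomputable def crossingSum {V : Type*} {G : SimpleGraph V} (D : RectilinearDrawing G)
    (k : ℕ) : ℕ :=
  {e | e ∈ G.edgeSet ∧ (D.crossingsOn e).encard ≤ (k : ℕ∞)}.ncard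

end RectilinearDrawing

/-- The largest value of `S_k(D)` over all rectilinear drawings `D` of `G`. -/
noncomputable def maxCrossingSum {V : Type*} (G : SimpleGraph V) (k : ℕ) : ℕ :=
  sSup (Set.range fun D : RectilinearDrawing G => D.crossingSum k)

/-! Upper bound. Let F be the set of edges with at most k crossings. A noncrossing straight-line
graph on m points has at most 3m edges (`IsNoncrossing.card_le`). This comes from charging rather
than from Euler's formula: an edge is charged to its left end if it is the lowest edge starting
there, to its right end if it is the lowest edge ending there, and otherwise to a vertex that sees
it directly above. A vertex receives at most one charge of each kind. Sampling the vertices with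
probability 1/q then yields |F|/q² ≤ 3n/q + |F|k/q⁴ (`card_mul_sq_le`), because crossing edges have
four distinct endpoints and an edge of F is crossed by at most k others. Taking q = 2⌈√k⌉ gives |F|
= O(n√k).

Lower bound. Split the vertices into clusters of m = ⌊√k⌋ + 1 points, the last one perhaps smaller.
Each cluster lies on a tiny concave arc, and the arcs are strung along a convex parabola, so that
every line spanned by a cluster passes below all other clusters. An edge inside a cluster is then
crossed only by edges of that cluster (`ConcaveClusters.key_eq_of_crossing`), of which there are at
most C(m,2) ≤ k. The ⌊n/m⌋ full clusters contain at least n√k/8 edges. The construction is given by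
strict orientation inequalities, so it survives a perturbation into general position without triple
points (`exists_rectilinearDrawing`). -/

/-! ### Noncrossing straight-line graphs have linearly many edges -/

/-- The value at abscissa `x` of the line through the points `(X e.1, Y e.1)` and
`(X e.2, Y e.2)`. -/
noncomputable def chordHeight {V : Type*} (X Y : V → ℝ) (e : V × V) (x : ℝ) : ℝ :=
  Y e.1 + (Y e.2 - Y e.1) / (X e.2 - X e.1) * (x - X e.1)

/-- The slope of the line through the points `(X e.1, Y e.1)` and `(X e.2, Y e.2)`. -/
noncomputable def chordSlope {V : Type*} (X Y : V → ℝ) (e : V × V) : ℝ :=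
  (Y e.2 - Y e.1) / (X e.2 - X e.1)

/-- A noncrossing family of straight-line edges, each oriented from left to right: the points have
distinct abscissas, no point lies on the line of an edge that does not end there, and distinct edges
have no common interior point. -/
structure IsNoncrossing {V : Type*} (X Y : V → ℝ) (E : Finset (V × V)) : Prop where
  inj : Function.Injective X
  lt : ∀ e ∈ E, X e.1 < X e.2
  off_line : ∀ e ∈ E, ∀ w, w ≠ e.1 → w ≠ e.2 → chordHeight X Y e (X w) ≠ Y w
  disjoint : ∀ e ∈ E, ∀ f ∈ E, e ≠ f → ∀ x, X e.1 < x → x < X e.2 → X f.1 < x → x < X f.2 →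
    chordHeight X Y e x ≠ chordHeight X Y f x

section Noncrossing

variable {V : Type*} {X Y : V → ℝ}

theorem chordHeight_eq_left (e : V × V) (x : ℝ) :
    chordHeight X Y e x = Y e.1 + chordSlope X Y e * (x - X e.1) := rfl

theorem chordHeight_eq_right {e : V × V} (he : X e.1 < X e.2) (x : ℝ) :
    chordHeight X Y e x = Y e.2 + chordSlope X Y e * (x - X e.2) := by
  have : X e.2 - X e.1 ≠ 0 := by linarith
  unfold chordHeight chordSlope
  field_simp
  ring

theorem chordHeight_sub (e : V × V) (x y : ℝ) :
    chordHeight X Y e x = chordHeight X Y e y + chordSlope X Y e * (x - y) := by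
  unfold chordHeight chordSlope
  ring

theorem chordHeight_left (e : V × V) : chordHeight X Y e (X e.1) = Y e.1 := by
  simp [chordHeight]

theorem chordHeight_right {e : V × V} (he : X e.1 < X e.2) :
    chordHeight X Y e (X e.2) = Y e.2 := by
  simp [chordHeight_eq_right he]

theorem chordHeight_swap (e : V × V) (he : X e.1 < X e.2) (x : ℝ) :
    chordHeight (fun v => -X v) Y e.swap (-x) = chordHeight X Y e x := by
  have h1 : X e.2 - X e.1 ≠ 0 := by linarith
  have h2 : -X e.1 + X e.2 ≠ 0 := by intro h; apply h1; linarith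
  simp only [chordHeight, Prod.fst_swap, Prod.snd_swap, sub_neg_eq_add]
  field_simp
  ring

theorem chordSlope_swap (e : V × V) :
    chordSlope (fun v => -X v) Y e.swap = -chordSlope X Y e := by
  simp only [chordSlope, Prod.fst_swap, Prod.snd_swap, sub_neg_eq_add]
  rw [← neg_sub (Y e.2), show -X e.1 + X e.2 = X e.2 - X e.1 by ring, neg_div]

/-- Two lines with no common point strictly between the abscissas `a` and `b` are ordered at `a`
as they are at `b`. -/
theorem chordHeight_le_of_lt {e f : V × V} {a b : ℝ}
    (hb : chordHeight X Y e b < chordHeight X Y f b)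
    (h : ∀ t, 0 < t → t < 1 → chordHeight X Y e (a + t * (b - a)) ≠
      chordHeight X Y f (a + t * (b - a))) :
    chordHeight X Y e a ≤ chordHeight X Y f a := by
  by_contra! hlt
  have e1 := chordHeight_sub (X := X) (Y := Y) e a b
  have f1 := chordHeight_sub (X := X) (Y := Y) f a b
  set p := chordHeight X Y e a - chordHeight X Y f a with hp
  set q := chordHeight X Y f b - chordHeight X Y e b with hq
  have hp0 : 0 < p := by linarith
  have hq0 : 0 < q := by linarith
  -- The affine difference of the two heights is p at `a` and -q at `b`, so this is the parameter of
  -- its zero.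
  refine h (p / (p + q)) (by positivity) (by rw [div_lt_one (by positivity)]; linarith) ?_
  rw [chordHeight_sub e _ a, chordHeight_sub f _ a]
  have hs : (chordSlope X Y e - chordSlope X Y f) * (b - a) = -(p + q) := by
    rw [hp, hq]; linarith
  have : p / (p + q) * (p + q) = p := by field_simp
  have : (chordSlope X Y e - chordSlope X Y f) * (p / (p + q) * (b - a)) = -p := by
    calc _ = p / (p + q) * ((chordSlope X Y e - chordSlope X Y f) * (b - a)) := by ring
      _ = _ := by rw [hs]; linarith
  have h3 : ∀ z : ℝ, a + z - a = z := fun z => by ring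
  rw [h3]
  linarith

/-- The vertex `w` lies vertically below the edge `e`, with no edge of `E` in between. -/
def SeesAbove (X Y : V → ℝ) (E : Finset (V × V)) (w : V) (e : V × V) : Prop :=
  X e.1 < X w ∧ X w < X e.2 ∧ Y w < chordHeight X Y e (X w) ∧
    ∀ h ∈ E, X h.1 < X w → X w < X h.2 → Y w < chordHeight X Y h (X w) →
      chordHeight X Y e (X w) ≤ chordHeight X Y h (X w)

/-- Reflection in a vertical line exchanges left and right ends, so arguments at left endpoints
carry over to right endpoints. -/
theorem IsNoncrossing.swap {E : Finset (V × V)} [DecidableEq V] (hE : IsNoncrossing X Y E) :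
    IsNoncrossing (fun v => -X v) Y (E.image Prod.swap) where
  inj := fun a b h => hE.inj (neg_injective h)
  lt := by
    simp only [Finset.mem_image]
    rintro _ ⟨e, he, rfl⟩
    simpa using hE.lt e he
  off_line := by
    simp only [Finset.mem_image]
    rintro _ ⟨e, he, rfl⟩ w h1 h2
    rw [chordHeight_swap e (hE.lt e he)]
    exact hE.off_line e he w h2 h1
  disjoint := by
    simp only [Finset.mem_image]
    rintro _ ⟨e, he, rfl⟩ _ ⟨f, hf, rfl⟩ hne x h1 h2 h3 h4
    obtain ⟨x, rfl⟩ : ∃ y, x = -y := ⟨-x, by simp⟩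
    rw [chordHeight_swap e (hE.lt e he), chordHeight_swap f (hE.lt f hf)]
    simp only [Prod.fst_swap, Prod.snd_swap] at h1 h2 h3 h4
    exact hE.disjoint e he f hf (fun h => hne (by rw [h])) x (by linarith) (by linarith)
      (by linarith) (by linarith)

/-- If the next lower edge at the left endpoint of `e` ends below `e`, then some vertex sees `e`. -/
theorem IsNoncrossing.exists_seesAbove {E : Finset (V × V)} {W : Finset V}
    (hE : IsNoncrossing X Y E) (hW : ∀ e ∈ E, e.1 ∈ W ∧ e.2 ∈ W) {e f : V × V} (he : e ∈ E)
    (hf : f ∈ E) (h1 : f.1 = e.1) (hs : chordSlope X Y f < chordSlope X Y e)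
    (hmax : ∀ h ∈ E, h.1 = e.1 → chordSlope X Y h < chordSlope X Y e →
      chordSlope X Y h ≤ chordSlope X Y f) (hlt : X f.2 < X e.2) :
    ∃ w ∈ W, SeesAbove X Y E w e := by
  classical
  have hfl := hE.lt f hf
  -- The vertices in the triangle between `f` and `e`, with the side `f` included so that `f.2`
  -- belongs to it. The leftmost such vertex sees `e`.
  let R := W.filter fun w => X e.1 < X w ∧ X w ≤ X f.2 ∧ chordHeight X Y f (X w) ≤ Y w ∧
    Y w < chordHeight X Y e (X w)
  have hR : R.Nonempty := by
    refine ⟨f.2, Finset.mem_filter.2 ⟨(hW f hf).2, by rw [← h1]; exact hfl, le_rfl, ?_, ?_⟩⟩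
    · rw [chordHeight_right hfl]
    · rw [← chordHeight_right (Y := Y) hfl, chordHeight_eq_left, chordHeight_eq_left, h1]
      have : 0 < X f.2 - X e.1 := by rw [← h1]; linarith
      gcongr
  obtain ⟨w, hwR, hmin⟩ := R.exists_min_image X hR
  obtain ⟨hwW, hw1, hw2, hw3, hw4⟩ := Finset.mem_filter.1 hwR
  refine ⟨w, hwW, hw1, by linarith, hw4, ?_⟩
  intro h hh ha hb hc
  by_contra! hd
  have hhe : h ≠ e := by rintro rfl; exact lt_irrefl _ hd
  have hhf : h ≠ f := by rintro rfl; linarith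
  have hfh : chordHeight X Y f (X w) < chordHeight X Y h (X w) := by linarith
  -- At `w` the edge `h` runs above `f` and below `e`. If it starts left of `e.1`, it is squeezed
  -- through that vertex; if it starts at `e.1`, its slope lies strictly between those of `f` and
  -- `e`; if it starts later, its left end is a vertex of `R` further left than `w`.
  rcases lt_trichotomy (X h.1) (X e.1) with hlt1 | heq | hgt
  · have k1 : chordHeight X Y f (X e.1) ≤ chordHeight X Y h (X e.1) := by
      refine chordHeight_le_of_lt (b := X w) hfh fun t t0 t1 => ?_
      have p1 : 0 < t * (X w - X e.1) := mul_pos t0 (by linarith)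
      have p2 : 0 < (1 - t) * (X w - X e.1) := mul_pos (by linarith) (by linarith)
      exact hE.disjoint f hf h hh hhf.symm _ (by rw [h1]; linarith) (by linarith) (by linarith)
        (by linarith)
    have k2 : chordHeight X Y h (X e.1) ≤ chordHeight X Y e (X e.1) := by
      refine chordHeight_le_of_lt (b := X w) hd fun t t0 t1 => ?_
      have p1 : 0 < t * (X w - X e.1) := mul_pos t0 (by linarith)
      have p2 : 0 < (1 - t) * (X w - X e.1) := mul_pos (by linarith) (by linarith)
      exact hE.disjoint h hh e he hhe _ (by linarith) (by linarith) (by linarith) (by linarith)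
    rw [chordHeight_left] at k2
    rw [← h1, chordHeight_left, h1] at k1
    refine hE.off_line h hh e.1 ?_ ?_ (le_antisymm k2 k1)
    · intro h0; rw [h0] at hlt1; exact lt_irrefl _ hlt1
    · intro h0; rw [h0] at hw1; linarith
  · have heq' := hE.inj heq
    have p0 : 0 < X w - X e.1 := by linarith
    have k1 : chordSlope X Y h < chordSlope X Y e := by
      rw [chordHeight_eq_left, chordHeight_eq_left, heq'] at hd
      by_contra! hcon
      nlinarith
    have k2 : chordSlope X Y f < chordSlope X Y h := by
      rw [chordHeight_eq_left, chordHeight_eq_left, heq', h1] at hfh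
      by_contra! hcon
      nlinarith
    linarith [hmax h hh heq' k1]
  · have k1 : chordHeight X Y f (X h.1) ≤ chordHeight X Y h (X h.1) := by
      refine chordHeight_le_of_lt (b := X w) hfh fun t t0 t1 => ?_
      have p1 : 0 < t * (X w - X h.1) := mul_pos t0 (by linarith)
      have p2 : 0 < (1 - t) * (X w - X h.1) := mul_pos (by linarith) (by linarith)
      exact hE.disjoint f hf h hh hhf.symm _ (by rw [h1]; linarith) (by linarith) (by linarith)
        (by linarith)
    have k2 : chordHeight X Y h (X h.1) ≤ chordHeight X Y e (X h.1) := by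
      refine chordHeight_le_of_lt (b := X w) hd fun t t0 t1 => ?_
      have p1 : 0 < t * (X w - X h.1) := mul_pos t0 (by linarith)
      have p2 : 0 < (1 - t) * (X w - X h.1) := mul_pos (by linarith) (by linarith)
      exact hE.disjoint h hh e he hhe _ (by linarith) (by linarith) (by linarith) (by linarith)
    rw [chordHeight_left] at k1 k2
    have k3 : Y h.1 ≠ chordHeight X Y e (X h.1) := by
      refine (hE.off_line e he h.1 ?_ ?_).symm
      · intro h0; rw [h0] at hgt; exact lt_irrefl _ hgt
      · intro h0; rw [h0] at ha; linarith
    have := hmin h.1 (Finset.mem_filter.2 ⟨(hW h hh).1, hgt, by linarith, k1, lt_of_le_of_ne k2 k3⟩)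
    linarith

theorem seesAbove_of_swap [DecidableEq V] {E : Finset (V × V)} (hE : IsNoncrossing X Y E)
    {w : V} {e : V × V} (he : e ∈ E)
    (h : SeesAbove (fun v => -X v) Y (E.image Prod.swap) w e.swap) : SeesAbove X Y E w e := by
  obtain ⟨h1, h2, h3, h4⟩ := h
  rw [chordHeight_swap e (hE.lt e he)] at h3
  simp only [Prod.fst_swap, Prod.snd_swap] at h1 h2
  refine ⟨by linarith, by linarith, h3, fun f hf a b c => ?_⟩
  have := h4 f.swap (Finset.mem_image_of_mem _ hf) (by simpa using b) (by simpa using a)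
    (by rwa [chordHeight_swap f (hE.lt f hf)])
  rwa [chordHeight_swap f (hE.lt f hf), chordHeight_swap e (hE.lt e he)] at this

theorem IsNoncrossing.eq_of_left {E : Finset (V × V)} (hE : IsNoncrossing X Y E) {e f : V × V}
    (he : e ∈ E) (hf : f ∈ E) (h : e.1 = f.1) (hs : chordSlope X Y e = chordSlope X Y f) :
    e = f := by
  by_contra hne
  have a := hE.lt e he
  have b := hE.lt f hf
  have c : X e.1 < min (X e.2) (X f.2) := lt_min a (by rw [h]; exact b)
  obtain ⟨x, hx1, hx2⟩ := exists_between c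
  obtain ⟨hx3, hx4⟩ := lt_min_iff.1 hx2
  exact hE.disjoint e he f hf hne x hx1 hx3 (by rwa [← h]) hx4
    (by rw [chordHeight_eq_left, chordHeight_eq_left, h, hs])

theorem IsNoncrossing.eq_of_right {E : Finset (V × V)} (hE : IsNoncrossing X Y E) {e f : V × V}
    (he : e ∈ E) (hf : f ∈ E) (h : e.2 = f.2) (hs : chordSlope X Y e = chordSlope X Y f) :
    e = f := by
  by_contra hne
  have a := hE.lt e he
  have b := hE.lt f hf
  have c : max (X e.1) (X f.1) < X e.2 := max_lt a (by rw [h]; exact b)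
  obtain ⟨x, hx1, hx2⟩ := exists_between c
  obtain ⟨hx3, hx4⟩ := max_lt_iff.1 hx1
  exact hE.disjoint e he f hf hne x hx3 hx2 hx4 (by rwa [← h])
    (by rw [chordHeight_eq_right a, chordHeight_eq_right b, h, hs])

/-- Every edge is the lowest one at its left endpoint, or the lowest one at its right endpoint, or
is seen from some vertex below it. -/
theorem IsNoncrossing.trichotomy {E : Finset (V × V)} {W : Finset V}
    (hE : IsNoncrossing X Y E) (hW : ∀ e ∈ E, e.1 ∈ W ∧ e.2 ∈ W) {e : V × V} (he : e ∈ E) :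
    (∀ f ∈ E, f.1 = e.1 → chordSlope X Y e ≤ chordSlope X Y f) ∨
    (∀ f ∈ E, f.2 = e.2 → chordSlope X Y f ≤ chordSlope X Y e) ∨
    ∃ w ∈ W, SeesAbove X Y E w e := by
  classical
  by_contra! hcon
  obtain ⟨⟨f₀, hf₀, hf₁, hf₂⟩, ⟨g₀, hg₀, hg₁, hg₂⟩, hw⟩ := hcon
  obtain ⟨f, hfm, hfmax⟩ := Finset.exists_max_image
    (E.filter fun f => f.1 = e.1 ∧ chordSlope X Y f < chordSlope X Y e) (chordSlope X Y)
    ⟨f₀, Finset.mem_filter.2 ⟨hf₀, hf₁, hf₂⟩⟩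
  obtain ⟨g, hgm, hgmin⟩ := Finset.exists_min_image
    (E.filter fun f => f.2 = e.2 ∧ chordSlope X Y e < chordSlope X Y f) (chordSlope X Y)
    ⟨g₀, Finset.mem_filter.2 ⟨hg₀, hg₁, hg₂⟩⟩
  obtain ⟨hf, hfe, hfs⟩ := Finset.mem_filter.1 hfm
  obtain ⟨hg, hge, hgs⟩ := Finset.mem_filter.1 hgm
  have hel := hE.lt e he
  have hfl := hE.lt f hf
  have hgl := hE.lt g hg
  rcases lt_or_ge (X f.2) (X e.2) with hfx | hfx
  · obtain ⟨w, hwW, hws⟩ := hE.exists_seesAbove hW he hf hfe hfs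
      (fun h hh h1 h2 => hfmax h (Finset.mem_filter.2 ⟨hh, h1, h2⟩)) hfx
    exact hw w hwW hws
  rcases lt_or_ge (X e.1) (X g.1) with hgx | hgx
  · obtain ⟨w, hwW, hws⟩ := hE.swap.exists_seesAbove (W := W) (e := e.swap) (f := g.swap)
      (by
        simp only [Finset.mem_image]
        rintro _ ⟨h, hh, rfl⟩
        exact (hW h hh).symm)
      (Finset.mem_image_of_mem _ he) (Finset.mem_image_of_mem _ hg) hge
      (by rw [chordSlope_swap, chordSlope_swap]; linarith)
      (by
        simp only [Finset.mem_image]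
        rintro _ ⟨h, hh, rfl⟩ h1 h2
        rw [chordSlope_swap, chordSlope_swap] at h2 ⊢
        have := hgmin h (Finset.mem_filter.2 ⟨hh, h1, by linarith⟩)
        linarith)
      (by simpa using hgx)
    exact hw w hwW (seesAbove_of_swap hE he hws)
  -- Now `f` reaches at least as far right as `e`, and `g` at least as far left. At the left end of
  -- `e`, `f` is above `g`; at the right end it is below, so the two would cross.
  have hfg : f ≠ g := by rintro rfl; linarith
  have key : chordHeight X Y f (X e.1) ≤ chordHeight X Y g (X e.1) := by
    refine chordHeight_le_of_lt (b := X e.2) ?_ fun t t0 t1 => ?_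
    · rw [← hge, chordHeight_right hgl, hge, ← chordHeight_right (Y := Y) hel, chordHeight_eq_left,
        chordHeight_eq_left, hfe]
      have : 0 < X e.2 - X e.1 := by linarith
      gcongr
    · have p1 : 0 < t * (X e.2 - X e.1) := mul_pos t0 (by linarith)
      have p2 : 0 < (1 - t) * (X e.2 - X e.1) := mul_pos (by linarith) (by linarith)
      exact hE.disjoint f hf g hg hfg _ (by rw [hfe]; linarith) (by linarith) (by linarith)
        (by rw [hge]; linarith)
  have h1 : chordHeight X Y f (X e.1) = chordHeight X Y e (X e.1) := by
    rw [chordHeight_left, ← hfe, chordHeight_left]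
  rw [h1, chordHeight_eq_right hel, chordHeight_eq_right hgl, hge] at key
  nlinarith

/-- A noncrossing straight-line graph on `m` points has at most `3 m` edges. -/
theorem IsNoncrossing.card_le {E : Finset (V × V)} {W : Finset V}
    (hE : IsNoncrossing X Y E) (hW : ∀ e ∈ E, e.1 ∈ W ∧ e.2 ∈ W) : E.card ≤ 3 * W.card := by
  classical
  let A := E.filter fun e => ∀ f ∈ E, f.1 = e.1 → chordSlope X Y e ≤ chordSlope X Y f
  let B := E.filter fun e => ∀ f ∈ E, f.2 = e.2 → chordSlope X Y f ≤ chordSlope X Y e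
  let C := E.filter fun e => ∃ w ∈ W, SeesAbove X Y E w e
  have hA : A.card ≤ W.card := by
    refine Finset.card_le_card_of_injOn Prod.fst
      (fun e he => (hW e (Finset.mem_filter.1 he).1).1) ?_
    intro e he f hf hef
    obtain ⟨he, he'⟩ := Finset.mem_filter.1 he
    obtain ⟨hf, hf'⟩ := Finset.mem_filter.1 hf
    exact hE.eq_of_left he hf hef (le_antisymm (he' f hf hef.symm) (hf' e he hef))
  have hB : B.card ≤ W.card := by
    refine Finset.card_le_card_of_injOn Prod.snd
      (fun e he => (hW e (Finset.mem_filter.1 he).1).2) ?_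
    intro e he f hf hef
    obtain ⟨he, he'⟩ := Finset.mem_filter.1 he
    obtain ⟨hf, hf'⟩ := Finset.mem_filter.1 hf
    exact hE.eq_of_right he hf hef (le_antisymm (hf' e he hef) (he' f hf hef.symm))
  have hC : C.card ≤ W.card := by
    refine Finset.card_le_card_of_forall_subsingleton (fun e w => SeesAbove X Y E w e)
      (fun e he => (Finset.mem_filter.1 he).2) ?_
    intro w _ e he f hf
    obtain ⟨he, h1, h2, h3, h4⟩ := he
    obtain ⟨hf, k1, k2, k3, k4⟩ := hf
    have he := (Finset.mem_filter.1 he).1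
    have hf := (Finset.mem_filter.1 hf).1
    by_contra hne
    exact hE.disjoint e he f hf hne _ h1 h2 k1 k2
      (le_antisymm (h4 f hf k1 k2 k3) (k4 e he h1 h2 h3))
  have hsub : E ⊆ A ∪ B ∪ C := by
    intro e he
    simp only [Finset.mem_union, A, B, C, Finset.mem_filter, he, true_and, or_assoc]
    exact hE.trichotomy hW he
  have := Finset.card_le_card hsub
  have := Finset.card_union_le (A ∪ B) C
  have := Finset.card_union_le A B
  omega

end Noncrossing

/-! ### The crossing lemma by sampling -/

/-- Colour 0 marks the sampled vertices; this is the probability q^(-|A|) that all of A is sampled,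
with denominators cleared. -/
theorem card_vanishing_mul {V : Type*} [Fintype V] [DecidableEq V] (q : ℕ) [NeZero q]
    (A : Finset V) :
    (Finset.univ.filter fun c : V → Fin q => ∀ v ∈ A, c v = 0).card * q ^ A.card =
      q ^ Fintype.card V := by
  have h : (Finset.univ.filter fun c : V → Fin q => ∀ v ∈ A, c v = 0) =
      Fintype.piFinset fun v => if v ∈ A then {0} else Finset.univ := by
    ext c
    simp only [Finset.mem_filter, Finset.mem_univ, true_and, Fintype.mem_piFinset]
    refine forall_congr' fun v => ?_
    split_ifs with hv <;> simp [hv]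
  have h2 : ∀ v, (if v ∈ A then ({0} : Finset (Fin q)) else Finset.univ).card =
      if v ∈ A then 1 else q := by
    intro v; split_ifs <;> simp
  rw [h, Fintype.card_piFinset, Finset.prod_congr rfl fun v _ => h2 v,
    ← Finset.prod_const, ← Finset.card_univ, ← Finset.prod_const,
    ← Finset.prod_filter_mul_prod_filter_not Finset.univ (· ∈ A)]
  have e1 : ∏ v ∈ Finset.univ.filter (· ∈ A), (if v ∈ A then 1 else q) = 1 :=
    Finset.prod_eq_one fun v hv => by simp_all
  have e2 : ∏ v ∈ Finset.univ.filter (· ∉ A), (if v ∈ A then 1 else q) =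
      ∏ v ∈ Finset.univ.filter (· ∉ A), q :=
    Finset.prod_congr rfl fun v hv => by simp_all
  rw [e1, e2, one_mul, ← Finset.prod_filter_mul_prod_filter_not (s := Finset.univ) (· ∈ A), mul_comm]
  simp

/-- The crossing lemma by sampling: a graph with at most `k` crossings on each edge, all of whose
crossing-free subgraphs on `m` vertices have at most `3 m` edges. -/
theorem card_mul_sq_le {V : Type*} [Fintype V] [DecidableEq V] (F : Finset (V × V))
    (cross : V × V → V × V → Prop) (k q : ℕ) (hq : 0 < q)
    (hne : ∀ e ∈ F, e.1 ≠ e.2)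
    (hdisj : ∀ e ∈ F, ∀ f ∈ F, cross e f → ({e.1, e.2, f.1, f.2} : Finset V).card = 4)
    (hdeg : ∀ e ∈ F, ∃ T : Finset (V × V), T.card ≤ k ∧ ∀ f ∈ F, cross e f → f ∈ T)
    (hplanar : ∀ (W : Finset V) (G : Finset (V × V)), G ⊆ F → (∀ e ∈ G, e.1 ∈ W ∧ e.2 ∈ W) →
      (∀ e ∈ G, ∀ f ∈ G, ¬ cross e f) → G.card ≤ 3 * W.card) :
    F.card * q ^ 2 ≤ 3 * Fintype.card V * q ^ 3 + F.card * k := by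
  classical
  have : NeZero q := ⟨hq.ne'⟩
  set n := Fintype.card V
  let P := (F ×ˢ F).filter fun p => cross p.1 p.2
  have hP : P.card ≤ F.card * k := by
    refine Finset.card_le_mul_card_image_of_maps_to (f := Prod.fst) (t := F) ?_ k ?_ |>.trans ?_
    · intro p hp
      exact (Finset.mem_product.1 (Finset.mem_filter.1 hp).1).1
    · intro e he
      obtain ⟨T, hT, hT'⟩ := hdeg e he
      refine le_trans (Finset.card_le_card_of_injOn Prod.snd (t := T) ?_ ?_) hT
      · intro p hp
        obtain ⟨hpP, hpe⟩ := Finset.mem_filter.1 hp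
        obtain ⟨hpF, hc⟩ := Finset.mem_filter.1 hpP
        rw [hpe] at hc
        exact hT' _ (Finset.mem_product.1 hpF).2 hc
      · intro p hp p' hp' h
        have h1 := (Finset.mem_filter.1 hp).2
        have h2 := (Finset.mem_filter.1 hp').2
        exact Prod.ext (h1.trans h2.symm) h
    · rw [mul_comm]
  -- For one sample: the sampled edges that cross no sampled edge fall under `hplanar`, and every
  -- other sampled edge is the first member of a sampled crossing pair.
  have main : ∀ c : V → Fin q,
      (F.filter fun e => c e.1 = 0 ∧ c e.2 = 0).card ≤
        3 * (Finset.univ.filter fun v => c v = 0).card +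
        (P.filter fun p => (c p.1.1 = 0 ∧ c p.1.2 = 0) ∧ (c p.2.1 = 0 ∧ c p.2.2 = 0)).card := by
    intro c
    set M := F.filter fun e => c e.1 = 0 ∧ c e.2 = 0
    set Q := P.filter fun p => (c p.1.1 = 0 ∧ c p.1.2 = 0) ∧ (c p.2.1 = 0 ∧ c p.2.2 = 0)
    let G := M.filter fun e => ∀ f ∈ M, ¬ cross e f
    have hG : G.card ≤ 3 * (Finset.univ.filter fun v => c v = 0).card := by
      apply hplanar
      · exact (Finset.filter_subset _ _).trans (Finset.filter_subset _ _)
      · intro e he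
        have := (Finset.mem_filter.1 (Finset.mem_filter.1 he).1).2
        simpa using this
      · intro e he f hf
        exact (Finset.mem_filter.1 he).2 f (Finset.mem_filter.1 hf).1
    have hsub : M ⊆ G ∪ Q.image Prod.fst := by
      intro e he
      by_cases h : ∀ f ∈ M, ¬ cross e f
      · exact Finset.mem_union_left _ (Finset.mem_filter.2 ⟨he, h⟩)
      · push Not at h
        obtain ⟨f, hf, hc⟩ := h
        refine Finset.mem_union_right _ (Finset.mem_image.2 ⟨(e, f), ?_, rfl⟩)
        obtain ⟨he1, he2⟩ := Finset.mem_filter.1 he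
        obtain ⟨hf1, hf2⟩ := Finset.mem_filter.1 hf
        exact Finset.mem_filter.2 ⟨Finset.mem_filter.2 ⟨Finset.mem_product.2 ⟨he1, hf1⟩, hc⟩,
          he2, hf2⟩
    have h1 := Finset.card_le_card hsub
    have h2 := Finset.card_union_le G (Q.image Prod.fst)
    have h3 := Finset.card_image_le (s := Q) (f := Prod.fst)
    omega
  have hsum := Finset.sum_le_sum fun c (_ : c ∈ (Finset.univ : Finset (V → Fin q))) => main c
  rw [Finset.sum_add_distrib, ← Finset.mul_sum] at hsum
  simp only [Finset.card_filter] at hsum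
  rw [Finset.sum_comm, Finset.sum_comm (s := Finset.univ) (t := Finset.univ),
    Finset.sum_comm (s := Finset.univ) (t := P)] at hsum
  simp only [← Finset.card_filter] at hsum
  have c1 : ∀ v : V, (Finset.univ.filter fun c : V → Fin q => c v = 0).card * q = q ^ n := by
    intro v
    have := card_vanishing_mul q ({v} : Finset V)
    simpa using this
  have c2 : ∀ e ∈ F, (Finset.univ.filter fun c : V → Fin q => c e.1 = 0 ∧ c e.2 = 0).card * q ^ 2 =
      q ^ n := by
    intro e he
    have := card_vanishing_mul q ({e.1, e.2} : Finset V)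
    rw [Finset.card_pair (hne e he)] at this
    simpa using this
  have c4 : ∀ p ∈ P, (Finset.univ.filter fun c : V → Fin q =>
      (c p.1.1 = 0 ∧ c p.1.2 = 0) ∧ (c p.2.1 = 0 ∧ c p.2.2 = 0)).card * q ^ 4 = q ^ n := by
    intro p hp
    obtain ⟨hp1, hp2⟩ := Finset.mem_filter.1 hp
    obtain ⟨hp3, hp4⟩ := Finset.mem_product.1 hp1
    have := card_vanishing_mul q ({p.1.1, p.1.2, p.2.1, p.2.2} : Finset V)
    rw [hdisj _ hp3 _ hp4 hp2] at this
    simpa [and_assoc] using this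
  -- Summation over all colourings replaces expectation; the factor q⁴ clears the probabilities 1/q,
  -- 1/q² and 1/q⁴ of a vertex, an edge and a crossing pair.
  have hsum' := Nat.mul_le_mul_right (q ^ 4) hsum
  rw [add_mul, mul_assoc, Finset.sum_mul, Finset.sum_mul, Finset.sum_mul] at hsum'
  have d2 : ∀ e ∈ F, (Finset.univ.filter fun c : V → Fin q => c e.1 = 0 ∧ c e.2 = 0).card * q ^ 4 =
      q ^ n * q ^ 2 := by
    intro e he
    rw [← c2 e he]; ring
  have d1 : ∀ v ∈ (Finset.univ : Finset V),
      (Finset.univ.filter fun c : V → Fin q => c v = 0).card * q ^ 4 = q ^ n * q ^ 3 := by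
    intro v _
    rw [← c1 v]; ring
  rw [Finset.sum_congr rfl d2, Finset.sum_congr rfl d1, Finset.sum_congr rfl c4] at hsum'
  simp only [Finset.sum_const, smul_eq_mul, Finset.card_univ] at hsum'
  have hqn : 0 < q ^ n := by positivity
  have : (F.card * q ^ 2) * q ^ n ≤ (3 * n * q ^ 3 + P.card) * q ^ n := by
    calc _ = F.card * (q ^ n * q ^ 2) := by ring
      _ ≤ _ := hsum'
      _ = _ := by ring
  have := Nat.le_of_mul_le_mul_right this hqn
  omega

/-! ### Orientation and segments in the plane -/

/-- Twice the signed area of the triangle `a b c`. -/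
def orient (a b c : Plane) : ℝ := (b 0 - a 0) * (c 1 - a 1) - (b 1 - a 1) * (c 0 - a 0)

theorem plane_ext {p q : Plane} (h0 : p 0 = q 0) (h1 : p 1 = q 1) : p = q := by
  ext i
  fin_cases i
  · exact h0
  · exact h1

theorem orient_eq_zero_iff {a b c : Plane} : orient a b c = 0 ↔ Collinear ℝ {a, b, c} := by
  constructor
  · intro h
    unfold orient at h
    by_cases hab : a = b
    · subst hab
      simpa using collinear_pair ℝ a c
    · rw [collinear_iff_of_mem (p₀ := a) (by simp)]
      refine ⟨b - a, ?_⟩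
      simp only [Set.mem_insert_iff, Set.mem_singleton_iff, forall_eq_or_imp, forall_eq]
      refine ⟨⟨0, by simp⟩, ⟨1, by simp⟩, ?_⟩
      by_cases h0 : b 0 - a 0 = 0
      · have h1 : b 1 - a 1 ≠ 0 := fun h1 => hab (plane_ext (by linarith) (by linarith))
        refine ⟨(c 1 - a 1) / (b 1 - a 1), plane_ext ?_ ?_⟩
        · have : c 0 - a 0 = 0 := by
            rw [h0] at h
            have : (b 1 - a 1) * (c 0 - a 0) = 0 := by linarith
            exact (mul_eq_zero.1 this).resolve_left h1
          simp [h0]; linarith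
        · simp; field_simp; ring
      · refine ⟨(c 0 - a 0) / (b 0 - a 0), plane_ext ?_ ?_⟩
        · simp; field_simp; ring
        · simp; field_simp; linarith
  · intro h
    rw [collinear_iff_of_mem (p₀ := a) (by simp)] at h
    obtain ⟨v, hv⟩ := h
    obtain ⟨r, hr⟩ := hv b (by simp)
    obtain ⟨s, hs⟩ := hv c (by simp)
    subst hr hs
    simp [orient]
    ring

theorem mem_openSegment_iff_coord {a b x : Plane} :
    x ∈ openSegment ℝ a b ↔ ∃ t : ℝ, 0 < t ∧ t < 1 ∧ x 0 = (1 - t) * a 0 + t * b 0 ∧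
      x 1 = (1 - t) * a 1 + t * b 1 := by
  rw [openSegment_eq_image]
  constructor
  · rintro ⟨t, ⟨h0, h1⟩, rfl⟩
    exact ⟨t, h0, h1, by simp, by simp⟩
  · rintro ⟨t, h0, h1, h2, h3⟩
    exact ⟨t, ⟨h0, h1⟩, plane_ext (by simp [h2]) (by simp [h3])⟩

theorem collinear_of_openSegments_from {a b c x : Plane} (hb : x ∈ openSegment ℝ a b)
    (hc : x ∈ openSegment ℝ a c) : Collinear ℝ {a, b, c} := by
  rw [← orient_eq_zero_iff]
  obtain ⟨s, s0, s1, hs0, hs1⟩ := mem_openSegment_iff_coord.1 hb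
  obtain ⟨t, t0, t1, ht0, ht1⟩ := mem_openSegment_iff_coord.1 hc
  have e0 : s * (b 0 - a 0) = t * (c 0 - a 0) := by linarith
  have e1 : s * (b 1 - a 1) = t * (c 1 - a 1) := by linarith
  have : s * orient a b c = 0 := by
    unfold orient
    linear_combination (c 1 - a 1) * e0 - (c 0 - a 0) * e1
  exact (mul_eq_zero.1 this).resolve_left s0.ne'

/-- Two open segments whose four endpoints are not collinear have at most one common point. -/
theorem openSegment_inter_subsingleton {a b c d : Plane} (h : ¬ Collinear ℝ {a, b, c}) :
    (openSegment ℝ a b ∩ openSegment ℝ c d).Subsingleton := by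
  rintro x ⟨hx, hx'⟩ y ⟨hy, hy'⟩
  rw [← orient_eq_zero_iff] at h
  obtain ⟨s, s0, s1, hs0, hs1⟩ := mem_openSegment_iff_coord.1 hx
  obtain ⟨t, t0, t1, ht0, ht1⟩ := mem_openSegment_iff_coord.1 hx'
  obtain ⟨s', s0', s1', hs0', hs1'⟩ := mem_openSegment_iff_coord.1 hy
  obtain ⟨t', t0', t1', ht0', ht1'⟩ := mem_openSegment_iff_coord.1 hy'
  have ex : (1 - t) * orient a b c + t * orient a b d = 0 := by
    unfold orient
    linear_combination (b 0 - a 0) * (hs1 - ht1) - (b 1 - a 1) * (hs0 - ht0)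
  have ey : (1 - t') * orient a b c + t' * orient a b d = 0 := by
    unfold orient
    linear_combination (b 0 - a 0) * (hs1' - ht1') - (b 1 - a 1) * (hs0' - ht0')
  have htt : (t' - t) * orient a b c = 0 := by
    linear_combination t' * ex - t * ey
  have : t' = t := by linarith [(mul_eq_zero.1 htt).resolve_right h]
  subst this
  exact plane_ext (by rw [ht0, ht0']) (by rw [ht1, ht1'])

/-! ### The upper bound for drawings -/

namespace RectilinearDrawing

variable {V : Type*}

/-- In general position, edges with a common interior point have no common endpoint. -/
theorem endpoints_ne {pos : V → Plane}
    (hgp : ∀ u v w : V, u ≠ v → u ≠ w → v ≠ w → ¬ Collinear ℝ ({pos u, pos v, pos w} : Set Plane))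
    {a b c d : V} {x : Plane} (hab : a ≠ b) (hcd : c ≠ d) (hne : s(a, b) ≠ s(c, d))
    (hx : x ∈ openSegment ℝ (pos a) (pos b)) (hx' : x ∈ openSegment ℝ (pos c) (pos d)) :
    a ≠ c ∧ a ≠ d ∧ b ≠ c ∧ b ≠ d := by
  have key : ∀ {a b c : V}, a ≠ b → a ≠ c → b ≠ c → x ∈ openSegment ℝ (pos a) (pos b) →
      x ∉ openSegment ℝ (pos a) (pos c) := fun hab hac hbc hx hx' =>
    hgp _ _ _ hab hac hbc (collinear_of_openSegments_from hx hx')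
  refine ⟨?_, ?_, ?_, ?_⟩
  · rintro rfl
    exact key hab hcd (fun h => hne (by rw [h])) hx hx'
  · rintro rfl
    rw [openSegment_symm ℝ (pos c)] at hx'
    exact key hab hcd.symm (fun h => hne (by rw [h, Sym2.eq_swap])) hx hx'
  · rintro rfl
    rw [openSegment_symm ℝ (pos a)] at hx
    exact key hab.symm hcd (fun h => hne (by rw [h, Sym2.eq_swap])) hx hx'
  · rintro rfl
    rw [openSegment_symm ℝ (pos a)] at hx
    rw [openSegment_symm ℝ (pos c)] at hx'
    exact key hab.symm hcd.symm (fun h => hne (by rw [h])) hx hx'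

/-- The shear (x, y) ↦ (x + ty, y) preserves lines and segments, and only finitely many t give two
points the same abscissa. -/
theorem exists_injective_abscissa [Fintype V] {pos : V → Plane} (hpos : Function.Injective pos) :
    ∃ t : ℝ, Function.Injective fun v => pos v 0 + t * pos v 1 := by
  obtain ⟨t, ht⟩ := Set.Finite.exists_notMem
    (Set.finite_range fun p : V × V => -(pos p.1 0 - pos p.2 0) / (pos p.1 1 - pos p.2 1))
  refine ⟨t, fun u v huv => hpos ?_⟩
  simp only at huv
  by_cases h1 : pos u 1 - pos v 1 = 0
  · have h1' : pos u 1 = pos v 1 := by linarith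
    rw [h1'] at huv
    exact plane_ext (by linarith) h1'
  · exact absurd ⟨(u, v), by simp only; field_simp; linarith⟩ ht

theorem collinear_of_chordHeight_eq {pos : V → Plane} {t : ℝ} {e : V × V} {w : V}
    (hlt : pos e.1 0 + t * pos e.1 1 < pos e.2 0 + t * pos e.2 1)
    (h : chordHeight (fun v => pos v 0 + t * pos v 1) (fun v => pos v 1) e
      (pos w 0 + t * pos w 1) = pos w 1) : Collinear ℝ {pos e.1, pos e.2, pos w} := by
  rw [← orient_eq_zero_iff]
  unfold chordHeight at h
  unfold orient
  have hL : pos e.2 0 + t * pos e.2 1 - (pos e.1 0 + t * pos e.1 1) ≠ 0 := by linarith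
  have hq := div_mul_cancel₀ (pos e.2 1 - pos e.1 1) hL
  linear_combination (pos w 0 + t * pos w 1 - (pos e.1 0 + t * pos e.1 1)) * hq -
    (pos e.2 0 + t * pos e.2 1 - (pos e.1 0 + t * pos e.1 1)) * h

theorem mem_openSegment_of_abscissa {pos : V → Plane} {t x : ℝ} {e : V × V}
    (h1 : pos e.1 0 + t * pos e.1 1 < x) (h2 : x < pos e.2 0 + t * pos e.2 1) {p : Plane}
    (hp : p 1 = chordHeight (fun v => pos v 0 + t * pos v 1) (fun v => pos v 1) e x)
    (hp' : p 0 = x - t * p 1) : p ∈ openSegment ℝ (pos e.1) (pos e.2) := by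
  rw [mem_openSegment_iff_coord]
  have h0 : 0 < pos e.2 0 + t * pos e.2 1 - (pos e.1 0 + t * pos e.1 1) := by linarith
  set L := pos e.2 0 + t * pos e.2 1 - (pos e.1 0 + t * pos e.1 1) with hL
  set r := (x - (pos e.1 0 + t * pos e.1 1)) / L with hr
  have hrL : r * L = x - (pos e.1 0 + t * pos e.1 1) := by rw [hr]; field_simp
  have hp2 : p 1 = (1 - r) * pos e.1 1 + r * pos e.2 1 := by
    rw [hp]
    unfold chordHeight
    simp only [← hL]
    rw [hr]; field_simp; ring
  refine ⟨r, ?_, ?_, ?_, hp2⟩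
  · exact div_pos (by linarith) h0
  · rw [hr, div_lt_one h0]; linarith
  · rw [hp', hp2]; rw [hL] at hrL; linarith

end RectilinearDrawing

namespace RectilinearDrawing

variable {V : Type*}

/-- At most `k` edges cross an edge that is part of at most `k` crossings. -/
theorem card_crossing_le (D : RectilinearDrawing (⊤ : SimpleGraph V)) {k : ℕ}
    {e : V × V} (hne : e.1 ≠ e.2) (he : (D.crossingsOn s(e.1, e.2)).encard ≤ (k : ℕ∞))
    (T : Finset (V × V)) (hinj : Set.InjOn (fun f : V × V => s(f.1, f.2)) T)
    (hT : ∀ f ∈ T, f.1 ≠ f.2 ∧ s(f.1, f.2) ≠ s(e.1, e.2) ∧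
      (edgeInterior D.pos s(e.1, e.2) ∩ edgeInterior D.pos s(f.1, f.2)).Nonempty) :
    T.card ≤ k := by
  choose! p hp using fun f hf => (hT f hf).2.2
  have h1 : (T : Set (V × V)).encard ≤ (D.crossingsOn s(e.1, e.2)).encard := by
    refine Set.encard_le_encard_of_injOn (f := p) ?_ ?_
    · intro f hf
      exact ⟨(hp f hf).1, s(f.1, f.2), (hT f hf).1, (hT f hf).2.1, (hp f hf).2⟩
    · intro f hf g hg hfg
      by_contra hne'
      -- Crossings are counted as points; two edges crossing `e` at the same point would make a
      -- triple point.
      have h := D.no_triple s(e.1, e.2) hne s(f.1, f.2) (hT f hf).1 s(g.1, g.2) (hT g hg).1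
        (hT f hf).2.1.symm (hT g hg).2.1.symm (fun h => hne' (hinj hf hg h))
      have : p f ∈ (∅ : Set Plane) := by
        rw [← h]
        exact ⟨hp f hf, by rw [hfg]; exact (hp g hg).2⟩
      exact this
  rw [Set.encard_coe_eq_coe_finsetCard] at h1
  exact_mod_cast h1.trans he

theorem crossingSum_mul_sq_le [Fintype V] (D : RectilinearDrawing (⊤ : SimpleGraph V)) (k q : ℕ)
    (hq : 0 < q) :
    D.crossingSum k * q ^ 2 ≤ 3 * Fintype.card V * q ^ 3 + D.crossingSum k * k := by
  classical
  obtain ⟨t, ht⟩ := exists_injective_abscissa D.pos_injective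
  set X : V → ℝ := fun v => D.pos v 0 + t * D.pos v 1 with hX
  -- Orienting edges from left to right represents each unordered edge exactly once.
  let F : Finset (V × V) := Finset.univ.filter fun e =>
    X e.1 < X e.2 ∧ (D.crossingsOn s(e.1, e.2)).encard ≤ (k : ℕ∞)
  have hFlt : ∀ e ∈ F, X e.1 < X e.2 := fun e he => (Finset.mem_filter.1 he).2.1
  have hFne : ∀ e ∈ F, e.1 ≠ e.2 := fun e he h => by
    have := hFlt e he
    rw [h] at this
    exact lt_irrefl _ this
  have hFinj : Set.InjOn (fun f : V × V => s(f.1, f.2)) F := by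
    intro e he f hf hef
    rcases Sym2.eq_iff.1 hef with ⟨h1, h2⟩ | ⟨h1, h2⟩
    · exact Prod.ext h1 h2
    · have a := hFlt e he
      have b := hFlt f hf
      rw [h1, h2] at a
      exact absurd a b.not_gt
  have hcard : D.crossingSum k = F.card := by
    have : {e | e ∈ (⊤ : SimpleGraph V).edgeSet ∧ (D.crossingsOn e).encard ≤ (k : ℕ∞)} =
        (F.image fun f : V × V => s(f.1, f.2) : Finset (Sym2 V)) := by
      ext e
      induction e with | _ a b
      simp only [SimpleGraph.mem_edgeSet, SimpleGraph.top_adj, Finset.coe_image, Set.mem_image,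
        Finset.mem_coe, Set.mem_ofPred_eq]
      constructor
      · rintro ⟨hab, hk⟩
        rcases lt_or_gt_of_ne (ht.ne hab) with h | h
        · exact ⟨(a, b), Finset.mem_filter.2 ⟨Finset.mem_univ _, h, hk⟩, rfl⟩
        · exact ⟨(b, a), Finset.mem_filter.2 ⟨Finset.mem_univ _, h, by rwa [Sym2.eq_swap]⟩,
            Sym2.eq_swap⟩
      · rintro ⟨e, he, h⟩
        have h1 : s(e.1, e.2) ∈ (⊤ : SimpleGraph V).edgeSet := hFne e he
        have h2 := (Finset.mem_filter.1 he).2.2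
        rw [h] at h1 h2
        exact ⟨h1, h2⟩
    rw [crossingSum, this, Set.ncard_coe_finset, Finset.card_image_of_injOn hFinj]
  rw [hcard]
  refine card_mul_sq_le F (fun e f => e ≠ f ∧
    (edgeInterior D.pos s(e.1, e.2) ∩ edgeInterior D.pos s(f.1, f.2)).Nonempty) k q hq hFne ?_ ?_ ?_
  · rintro e he f hf ⟨hef, x, hx, hx'⟩
    obtain ⟨h1, h2, h3, h4⟩ := endpoints_ne D.general_position (hFne e he) (hFne f hf)
      (fun h => hef (hFinj he hf h)) hx hx'
    have h5 := hFne e he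
    have h6 := hFne f hf
    rw [Finset.card_insert_of_notMem (by simp [h1, h2, h5]),
      Finset.card_insert_of_notMem (by simp [h3, h4]), Finset.card_pair h6]
  · intro e he
    refine ⟨F.filter fun f => e ≠ f ∧
      (edgeInterior D.pos s(e.1, e.2) ∩ edgeInterior D.pos s(f.1, f.2)).Nonempty, ?_,
      fun f hf h => Finset.mem_filter.2 ⟨hf, h⟩⟩
    refine D.card_crossing_le (hFne e he) (Finset.mem_filter.1 he).2.2 _
      (hFinj.mono (Finset.coe_subset.2 (Finset.filter_subset _ _))) ?_
    intro f hf
    obtain ⟨hf, hef, h⟩ := Finset.mem_filter.1 hf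
    exact ⟨hFne f hf, fun h => hef (hFinj hf he h).symm, h⟩
  · intro W G hGF hGW hG
    have hnc : IsNoncrossing X (fun v => D.pos v 1) G := by
      refine ⟨ht, fun e he => hFlt e (hGF he), fun e he w h1 h2 h => ?_,
        fun e he f hf hef x h1 h2 h3 h4 h => ?_⟩
      · exact D.general_position e.1 e.2 w (hFne e (hGF he)) h1.symm h2.symm
          (collinear_of_chordHeight_eq (hFlt e (hGF he)) h)
      · refine hG e he f hf ⟨hef, !₂[x - t * chordHeight X (fun v => D.pos v 1) e x,
          chordHeight X (fun v => D.pos v 1) e x], ?_, ?_⟩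
        · exact mem_openSegment_of_abscissa h1 h2 (by simp [hX]) (by simp)
        · exact mem_openSegment_of_abscissa h3 h4 (by rw [← hX, ← h]; simp) (by simp)
    exact hnc.card_le hGW

theorem crossingSum_le [Fintype V] (D : RectilinearDrawing (⊤ : SimpleGraph V)) {k : ℕ} (hk : 1 ≤ k) :
    (D.crossingSum k : ℝ) ≤ 24 * (Fintype.card V * √(k : ℝ)) := by
  set r := ⌈√(k : ℝ)⌉₊
  have hk1 : (1 : ℝ) ≤ √(k : ℝ) := Real.one_le_sqrt.2 (by exact_mod_cast hk)
  have h1 : √(k : ℝ) ≤ r := Nat.le_ceil _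
  have h2 : (r : ℝ) < √(k : ℝ) + 1 := Nat.ceil_lt_add_one (by positivity)
  have hr0 : 0 < r := by
    have : (0 : ℝ) < r := by linarith
    exact_mod_cast this
  -- With q = 2r the crossing term S·k ≤ S·r² is at most a quarter of S·q² and can be absorbed.
  have h := D.crossingSum_mul_sq_le k (2 * r) (by omega)
  have h' : (D.crossingSum k : ℝ) * (2 * r) ^ 2 ≤
      3 * Fintype.card V * (2 * r) ^ 3 + D.crossingSum k * k := by exact_mod_cast h
  have hkr : (k : ℝ) ≤ r ^ 2 := by
    calc (k : ℝ) = √(k : ℝ) ^ 2 := (Real.sq_sqrt (by positivity)).symm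
      _ ≤ _ := by gcongr
  have hS : (D.crossingSum k : ℝ) * k ≤ D.crossingSum k * r ^ 2 := by gcongr
  have hr2 : (0 : ℝ) < r ^ 2 := by positivity
  have h3 : (D.crossingSum k : ℝ) * r ^ 2 ≤ (12 * (Fintype.card V * r)) * r ^ 2 := by
    have : (0 : ℝ) ≤ D.crossingSum k * r ^ 2 := by positivity
    nlinarith
  have h4 := le_of_mul_le_mul_right h3 hr2
  have h5 : (r : ℝ) ≤ 2 * √(k : ℝ) := by linarith
  calc (D.crossingSum k : ℝ) ≤ 12 * (Fintype.card V * r) := h4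
    _ ≤ 12 * (Fintype.card V * (2 * √(k : ℝ))) := by gcongr
    _ = _ := by ring

end RectilinearDrawing

/-! ### Drawings with vertices in prescribed open sets -/

/-- Generic position of the points `pos v`, `v ∈ s`. -/
structure GenericOn {V : Type*} (pos : V → Plane) (s : Finset V) : Prop where
  injOn : Set.InjOn pos s
  orient_ne : ∀ u ∈ s, ∀ v ∈ s, ∀ w ∈ s, u ≠ v → u ≠ w → v ≠ w →
    orient (pos u) (pos v) (pos w) ≠ 0
  no_triple : ∀ a ∈ s, ∀ b ∈ s, ∀ c ∈ s, ∀ d ∈ s, ∀ e ∈ s, ∀ f ∈ s,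
    [a, b, c, d, e, f].Nodup → ∀ x, x ∈ openSegment ℝ (pos a) (pos b) →
      x ∈ openSegment ℝ (pos c) (pos d) → x ∉ openSegment ℝ (pos e) (pos f)

open MeasureTheory in
theorem ae_notMem_line (a b : Plane) : ∀ᵐ p : Plane, p ∉ affineSpan ℝ ({a, b} : Set Plane) := by
  have h : (affineSpan ℝ ({a, b} : Set Plane)) ≠ ⊤ := by
    intro h
    have h1 := (collinear_iff_finrank_le_one (k := ℝ)).1 (collinear_pair ℝ a b)
    rw [← direction_affineSpan, h, AffineSubspace.direction_top, finrank_top] at h1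
    simp at h1
  have := Measure.addHaar_affineSubspace (volume : Measure Plane) _ h
  exact measure_eq_zero_iff_ae_notMem.1 this

theorem mem_line_of_orient_eq_zero {a b p : Plane} (hab : a ≠ b) (h : orient a b p = 0) :
    p ∈ affineSpan ℝ ({a, b} : Set Plane) :=
  (orient_eq_zero_iff.1 h).mem_affineSpan_of_mem_of_ne (by simp) (by simp) (by simp) hab

theorem orient_rotate (a b c : Plane) : orient a b c = orient b c a := by
  unfold orient; ring

theorem nodup_six_swaps {V : Type*} {a b c d e f : V} (h : [a, b, c, d, e, f].Nodup) :
    [b, a, c, d, e, f].Nodup ∧ [c, d, a, b, e, f].Nodup ∧ [d, c, a, b, e, f].Nodup ∧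
      [e, f, a, b, c, d].Nodup ∧ [f, e, a, b, c, d].Nodup := by
  simp only [List.nodup_cons, List.mem_cons, List.not_mem_nil, not_or, or_false, not_false_eq_true,
    List.nodup_nil, and_true, @eq_comm V] at h ⊢
  simp [h]

open MeasureTheory in
/-- One more point can be added in generic position inside any nonempty open set. -/
theorem GenericOn.exists_update {V : Type*} [Fintype V] [DecidableEq V] {pos : V → Plane}
    {s : Finset V} (h : GenericOn pos s) {v : V} (hv : v ∉ s) {U : Set Plane} (hU : IsOpen U)
    (hne : U.Nonempty) : ∃ p ∈ U, GenericOn (Function.update pos v p) (insert v s) := by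
  -- The new point must avoid finitely many lines: those through two old points, and those joining
  -- an old point to the intersection of two old segments. For a = b the span is a single point,
  -- which keeps the new point distinct from the old ones.
  have hae : ∀ᵐ p : Plane, (∀ a b : V, p ∉ affineSpan ℝ ({pos a, pos b} : Set Plane)) ∧
      ∀ b c d e f : V, b ∈ s → c ∈ s → d ∈ s → e ∈ s → f ∈ s → [b, c, d, e, f].Nodup →
        ∀ x ∈ openSegment ℝ (pos c) (pos d) ∩ openSegment ℝ (pos e) (pos f),
          p ∉ affineSpan ℝ ({pos b, x} : Set Plane) := by
    refine Filter.Eventually.and ?_ ?_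
    · simp only [ae_all_iff]
      exact fun a b => ae_notMem_line _ _
    · simp only [ae_all_iff]
      intro b c d e f hb hc hd he hf hnd
      have hsub : (openSegment ℝ (pos c) (pos d) ∩ openSegment ℝ (pos e) (pos f)).Subsingleton := by
        apply openSegment_inter_subsingleton
        rw [← orient_eq_zero_iff]
        simp only [List.nodup_cons, List.mem_cons, List.not_mem_nil, not_or] at hnd
        exact h.orient_ne c hc d hd e he hnd.2.1.1 hnd.2.1.2.1 hnd.2.2.1.1
      rw [ae_ball_iff hsub.countable]
      exact fun x _ => ae_notMem_line _ _
  obtain ⟨p, ⟨hp1, hp2⟩, hpU⟩ := (Measure.dense_of_ae hae).exists_mem_open hU hne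
  refine ⟨p, hpU, ?_⟩
  have hold : ∀ u, u ≠ v → Function.update pos v p u = pos u := fun u hu =>
    Function.update_of_ne hu _ _
  have hnew : Function.update pos v p v = p := Function.update_self _ _ _
  have hmem : ∀ u ∈ insert v s, u ≠ v → u ∈ s := fun u hu huv =>
    (Finset.mem_insert.1 hu).resolve_left huv
  have hpne : ∀ u, pos u ≠ p := by
    rintro u rfl
    exact hp1 u u (by simp)
  have core2 : ∀ b ∈ s, ∀ c ∈ s, b ≠ c → orient (pos b) (pos c) p ≠ 0 := by
    intro b hb c hc hbc h0
    exact hp1 b c (mem_line_of_orient_eq_zero (fun h' => hbc (h.injOn hb hc h')) h0)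
  have core : ∀ b ∈ s, ∀ c ∈ s, ∀ d ∈ s, ∀ e ∈ s, ∀ f ∈ s, [b, c, d, e, f].Nodup →
      ∀ x, x ∈ openSegment ℝ p (pos b) → x ∈ openSegment ℝ (pos c) (pos d) →
      x ∉ openSegment ℝ (pos e) (pos f) := by
    intro b hb c hc d hd e he f hf hnd x hx1 hx2 hx3
    refine hp2 b c d e f hb hc hd he hf hnd x ⟨hx2, hx3⟩ ?_
    have hbx : pos b ≠ x := by
      rintro rfl
      obtain ⟨t, -, -, h0, h1⟩ := mem_openSegment_iff_coord.1 hx2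
      simp only [List.nodup_cons, List.mem_cons, List.not_mem_nil, not_or] at hnd
      refine h.orient_ne c hc d hd b hb hnd.2.1.1 (Ne.symm hnd.1.1) (Ne.symm hnd.1.2.1) ?_
      unfold orient
      rw [h0, h1]; ring
    refine mem_line_of_orient_eq_zero hbx ?_
    obtain ⟨t, -, -, h0, h1⟩ := mem_openSegment_iff_coord.1 hx1
    unfold orient
    rw [h0, h1]; ring
  refine ⟨?_, ?_, ?_⟩
  · intro u hu w hw huw
    by_cases huv : u = v <;> by_cases hwv : w = v
    · rw [huv, hwv]
    · rw [huv, hnew, hold w hwv] at huw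
      exact absurd huw.symm (hpne w)
    · rw [hwv, hnew, hold u huv] at huw
      exact absurd huw (hpne u)
    · rw [hold u huv, hold w hwv] at huw
      exact h.injOn (hmem u hu huv) (hmem w hw hwv) huw
  · intro a ha b hb c hc hab hac hbc
    by_cases hav : a = v
    · subst hav
      rw [hnew, hold b hab.symm, hold c hac.symm, orient_rotate]
      exact core2 b (hmem b hb hab.symm) c (hmem c hc hac.symm) hbc
    by_cases hbv : b = v
    · subst hbv
      rw [hnew, hold a hav, hold c hbc.symm, ← orient_rotate]
      exact core2 c (hmem c hc hbc.symm) a (hmem a ha hav) hac.symm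
    by_cases hcv : c = v
    · subst hcv
      rw [hnew, hold a hav, hold b hbv]
      exact core2 a (hmem a ha hav) b (hmem b hb hbv) hab
    rw [hold a hav, hold b hbv, hold c hcv]
    exact h.orient_ne a (hmem a ha hav) b (hmem b hb hbv) c (hmem c hc hcv) hab hac hbc
  -- By symmetry of the six endpoints, it is enough to treat the new vertex in first place.
  · have core' : ∀ b ∈ insert v s, ∀ c ∈ insert v s, ∀ d ∈ insert v s, ∀ e ∈ insert v s,
        ∀ f ∈ insert v s, [v, b, c, d, e, f].Nodup →
        ∀ x, x ∈ openSegment ℝ (Function.update pos v p v) (Function.update pos v p b) →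
        x ∈ openSegment ℝ (Function.update pos v p c) (Function.update pos v p d) →
        x ∉ openSegment ℝ (Function.update pos v p e) (Function.update pos v p f) := by
      intro b hb c hc d hd e he f hf hnd x
      rw [List.nodup_cons] at hnd
      have hnv := hnd.1
      simp only [List.mem_cons, List.not_mem_nil, not_or, or_false] at hnv
      obtain ⟨n1, n2, n3, n4, n5⟩ := hnv
      rw [hnew, hold b (Ne.symm n1), hold c (Ne.symm n2), hold d (Ne.symm n3), hold e (Ne.symm n4),
        hold f (Ne.symm n5)]
      exact core b (hmem b hb (Ne.symm n1)) c (hmem c hc (Ne.symm n2)) d (hmem d hd (Ne.symm n3))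
        e (hmem e he (Ne.symm n4)) f (hmem f hf (Ne.symm n5)) hnd.2 x
    intro a ha b hb c hc d hd e he f hf hnd x h1 h2 h3
    obtain ⟨s1, s2, s3, s4, s5⟩ := nodup_six_swaps hnd
    by_cases hav : a = v
    · subst hav
      exact core' b hb c hc d hd e he f hf hnd x h1 h2 h3
    by_cases hbv : b = v
    · subst hbv
      rw [openSegment_symm] at h1
      exact core' a ha c hc d hd e he f hf s1 x h1 h2 h3
    by_cases hcv : c = v
    · subst hcv
      exact core' d hd a ha b hb e he f hf s2 x h2 h1 h3
    by_cases hdv : d = v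
    · subst hdv
      rw [openSegment_symm] at h2
      exact core' c hc a ha b hb e he f hf s3 x h2 h1 h3
    by_cases hev : e = v
    · subst hev
      exact core' f hf a ha b hb c hc d hd s4 x h3 h1 h2
    by_cases hfv : f = v
    · subst hfv
      rw [openSegment_symm] at h3
      exact core' e he a ha b hb c hc d hd s5 x h3 h1 h2
    rw [hold a hav, hold b hbv] at h1
    rw [hold c hcv, hold d hdv] at h2
    rw [hold e hev, hold f hfv] at h3
    exact h.no_triple a (hmem a ha hav) b (hmem b hb hbv) c (hmem c hc hcv) d (hmem d hd hdv)
      e (hmem e he hev) f (hmem f hf hfv) hnd x h1 h2 h3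

theorem exists_genericOn {V : Type*} [Fintype V] [DecidableEq V] (U : V → Set Plane)
    (hU : ∀ v, IsOpen (U v)) (hne : ∀ v, (U v).Nonempty) (s : Finset V) :
    ∃ pos : V → Plane, (∀ v ∈ s, pos v ∈ U v) ∧ GenericOn pos s := by
  induction s using Finset.induction_on with
  | empty => exact ⟨fun _ => 0, by simp, by simp, by simp, by simp⟩
  | insert v s hv ih =>
    obtain ⟨pos, h1, h2⟩ := ih
    obtain ⟨p, hp, h3⟩ := h2.exists_update hv (hU v) (hne v)
    refine ⟨_, fun u hu => ?_, h3⟩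
    by_cases huv : u = v
    · subst huv
      simpa using hp
    · rw [Function.update_of_ne huv]
      exact h1 u ((Finset.mem_insert.1 hu).resolve_left huv)

/-- There is a rectilinear drawing with each vertex in a prescribed nonempty open set. -/
theorem exists_rectilinearDrawing {V : Type*} [Fintype V] (G : SimpleGraph V) (U : V → Set Plane)
    (hU : ∀ v, IsOpen (U v)) (hne : ∀ v, (U v).Nonempty) :
    ∃ D : RectilinearDrawing G, ∀ v, D.pos v ∈ U v := by
  classical
  obtain ⟨pos, h1, h2⟩ := exists_genericOn U hU hne Finset.univ
  have hgp : ∀ u v w : V, u ≠ v → u ≠ w → v ≠ w →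
      ¬ Collinear ℝ ({pos u, pos v, pos w} : Set Plane) := by
    intro u v w huv huw hvw h
    exact h2.orient_ne u (by simp) v (by simp) w (by simp) huv huw hvw (orient_eq_zero_iff.2 h)
  refine ⟨⟨pos, fun u v h => h2.injOn (by simp) (by simp) h, hgp, ?_⟩, fun v => h1 v (by simp)⟩
  intro e₁ he₁ e₂ he₂ e₃ he₃ h12 h13 h23
  induction e₁ with | _ a b
  induction e₂ with | _ c d
  induction e₃ with | _ e f
  rw [Set.eq_empty_iff_forall_notMem]
  rintro x ⟨⟨hx1, hx2⟩, hx3⟩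
  have hab : a ≠ b := G.ne_of_adj he₁
  have hcd : c ≠ d := G.ne_of_adj he₂
  have hef : e ≠ f := G.ne_of_adj he₃
  -- General position already makes the endpoints of crossing edges distinct, so only six distinct
  -- vertices remain to be considered.
  obtain ⟨p1, p2, p3, p4⟩ := RectilinearDrawing.endpoints_ne hgp hab hcd h12 hx1 hx2
  obtain ⟨q1, q2, q3, q4⟩ := RectilinearDrawing.endpoints_ne hgp hab hef h13 hx1 hx3
  obtain ⟨r1, r2, r3, r4⟩ := RectilinearDrawing.endpoints_ne hgp hcd hef h23 hx2 hx3
  exact h2.no_triple a (by simp) b (by simp) c (by simp) d (by simp) e (by simp) f (by simp)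
    (by simp [*]) x hx1 hx2 hx3

/-! ### Concave clusters and the lower bound -/

theorem orient_of_mem_openSegment {a b c d x : Plane} (hx : x ∈ openSegment ℝ c d) :
    ∃ t : ℝ, 0 < t ∧ t < 1 ∧ orient a b x = (1 - t) * orient a b c + t * orient a b d := by
  obtain ⟨t, t0, t1, h0, h1⟩ := mem_openSegment_iff_coord.1 hx
  refine ⟨t, t0, t1, ?_⟩
  unfold orient
  rw [h0, h1]; ring

theorem orient_swap (a b c : Plane) : orient a c b = -orient a b c := by
  unfold orient; ring

theorem orient_self_left (a b : Plane) : orient a b a = 0 := by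
  unfold orient; ring

theorem orient_self_right (a b : Plane) : orient a b b = 0 := by
  unfold orient; ring

/-- The points with the same value of `key` form, in increasing order, a concave chain, and all
other points lie above the lines spanned by this chain. -/
structure ConcaveClusters {n : ℕ} (key : Fin n → ℕ) (pos : Fin n → Plane) : Prop where
  outside : ∀ i j w, i < j → key i = key j → key w ≠ key i → 0 < orient (pos i) (pos j) (pos w)
  inside : ∀ i j l, i < j → j < l → key i = key j → key l = key i →
    orient (pos i) (pos j) (pos l) < 0

namespace ConcaveClusters

variable {n : ℕ} {key : Fin n → ℕ} {pos : Fin n → Plane}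

/-- A separating line exists in each case. If u is in another cluster, or between a and b in the
chain, then u and w both lie above the line ab. If u precedes a, the line ua has b below it and w
above it; if u follows b, the line bu separates a from w. -/
theorem notMem_of_outside (h : ConcaveClusters key pos) {a b u w : Fin n} (hab : a < b)
    (hk : key a = key b) (hua : u ≠ a) (hub : u ≠ b) (hw : key w ≠ key a) {x : Plane}
    (hx : x ∈ openSegment ℝ (pos a) (pos b)) : x ∉ openSegment ℝ (pos u) (pos w) := by
  intro hx'
  have above : 0 < orient (pos a) (pos b) (pos u) → False := by
    intro hu
    obtain ⟨s, s0, s1, hs⟩ := orient_of_mem_openSegment (a := pos a) (b := pos b) hx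
    obtain ⟨t, t0, t1, ht⟩ := orient_of_mem_openSegment (a := pos a) (b := pos b) hx'
    rw [orient_self_left, orient_self_right] at hs
    have h1 := mul_pos (sub_pos.2 t1) hu
    have h2 := mul_pos t0 (h.outside a b w hab hk hw)
    linarith
  by_cases hu : key u = key a
  · rcases lt_or_gt_of_ne hua with hlt | hgt
    · obtain ⟨s, s0, s1, hs⟩ := orient_of_mem_openSegment (a := pos u) (b := pos a) hx
      obtain ⟨t, t0, t1, ht⟩ := orient_of_mem_openSegment (a := pos u) (b := pos a) hx'
      rw [orient_self_right] at hs
      rw [orient_self_left] at ht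
      have h1 := mul_pos s0 (neg_pos.2 (h.inside u a b hlt hab hu (hk.symm.trans hu.symm)))
      have h2 := mul_pos t0 (h.outside u a w hlt hu (fun h' => hw (h'.trans hu)))
      linarith
    rcases lt_or_gt_of_ne hub with hlt' | hgt'
    · have := h.inside a u b hgt hlt' hu.symm hk.symm
      exact above (by rw [orient_swap]; linarith)
    · obtain ⟨s, s0, s1, hs⟩ := orient_of_mem_openSegment (a := pos b) (b := pos u) hx
      obtain ⟨t, t0, t1, ht⟩ := orient_of_mem_openSegment (a := pos b) (b := pos u) hx'
      rw [orient_self_left, ← orient_rotate (pos a)] at hs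
      rw [orient_self_right] at ht
      have h1 := mul_pos (sub_pos.2 s1) (neg_pos.2 (h.inside a b u hab hgt' hk hu))
      have h2 := mul_pos t0 (h.outside b u w hgt' (hk.symm.trans hu.symm)
        (fun h' => hw (h'.trans hk.symm)))
      linarith
  · exact above (h.outside a b u hab hk hu)

/-- An edge that crosses an edge inside a cluster lies in the same cluster. -/
theorem key_eq_of_crossing (h : ConcaveClusters key pos) {a b u w : Fin n} (hab : a ≠ b)
    (hk : key a = key b) (hua : u ≠ a) (hub : u ≠ b) (hwa : w ≠ a) (hwb : w ≠ b) {x : Plane}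
    (hx : x ∈ openSegment ℝ (pos a) (pos b)) (hx' : x ∈ openSegment ℝ (pos u) (pos w)) :
    key u = key a ∧ key w = key a := by
  wlog hlt : a < b generalizing a b
  · have := this hab.symm hk.symm hub hua hwb hwa (by rwa [openSegment_symm])
      (lt_of_le_of_ne (not_lt.1 hlt) hab.symm)
    rwa [hk]
  constructor
  · by_contra hu
    rw [openSegment_symm] at hx'
    exact h.notMem_of_outside hlt hk hwa hwb hu hx hx'
  · by_contra hw
    exact h.notMem_of_outside hlt hk hua hub hw hx hx'

end ConcaveClusters

/-- The parabola with a small concave arc in place of each integer point. -/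
noncomputable def clusterPoint (m : ℕ) {n : ℕ} (i : Fin n) : Plane :=
  !₂[((i / m : ℕ) : ℝ) + ((i % m : ℕ) : ℝ) / (8 * m),
    (((i / m : ℕ) : ℝ) + ((i % m : ℕ) : ℝ) / (8 * m)) ^ 2 - 2 * (((i % m : ℕ) : ℝ) / (8 * m)) ^ 2]

/-- At offset α from the integer c the ordinate is c² + 2cα - α²: subtracting 2α² reverses the
curvature inside a cluster. Offsets are at most 1/8, too small to disturb the convexity between
clusters. -/
theorem concaveClusters_clusterPoint {m : ℕ} (hm : 0 < m) (n : ℕ) :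
    ConcaveClusters (fun i : Fin n => (i / m : ℕ)) (clusterPoint m) := by
  have hm' : (0 : ℝ) < 8 * m := by positivity
  have hs0 : ∀ i : Fin n, 0 ≤ ((i % m : ℕ) : ℝ) / (8 * m) := fun i => by positivity
  have hs1 : ∀ i : Fin n, ((i % m : ℕ) : ℝ) / (8 * m) ≤ 1 / 8 := fun i => by
    have : ((i % m : ℕ) : ℝ) ≤ m := by exact_mod_cast (Nat.mod_lt _ hm).le
    rw [div_le_div_iff₀ hm' (by norm_num)]
    linarith
  have hlt : ∀ i j : Fin n, i < j → (i / m : ℕ) = (j / m : ℕ) →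
      ((i % m : ℕ) : ℝ) / (8 * m) < ((j % m : ℕ) : ℝ) / (8 * m) := fun i j hij hk => by
    have h1 := Nat.div_add_mod (i : ℕ) m
    have h2 := Nat.div_add_mod (j : ℕ) m
    rw [hk] at h1
    have h3 : (i : ℕ) < j := hij
    have : (i % m : ℕ) < (j % m : ℕ) := by omega
    gcongr
  constructor
  · intro i j w hij hk hw
    have hα0 := hs0 i
    have hα1 := hs1 i
    have hβ0 := hs0 j
    have hβ1 := hs1 j
    have hγ0 := hs0 w
    have hγ1 := hs1 w
    have hαβ := hlt i j hij hk
    have hD : (1 : ℝ) ≤ ((w / m : ℕ) : ℝ) - ((i / m : ℕ) : ℝ) ∨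
        (1 : ℝ) ≤ ((i / m : ℕ) : ℝ) - ((w / m : ℕ) : ℝ) := by
      rcases lt_or_gt_of_ne hw with h | h
      · right
        have : (((w / m : ℕ) + 1 : ℕ) : ℝ) ≤ ((i / m : ℕ) : ℝ) := Nat.cast_le.2 h
        push_cast at this ⊢
        linarith
      · left
        have : (((i / m : ℕ) + 1 : ℕ) : ℝ) ≤ ((w / m : ℕ) : ℝ) := Nat.cast_le.2 h
        push_cast at this ⊢
        linarith
    simp only [orient, clusterPoint, PiLp.toLp_apply, Matrix.cons_val_zero, Matrix.cons_val_one,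
      ← hk]
    generalize ((i % m : ℕ) : ℝ) / (8 * m) = α at *
    generalize ((j % m : ℕ) : ℝ) / (8 * m) = β at *
    generalize ((w % m : ℕ) : ℝ) / (8 * m) = γ at *
    generalize ((w / m : ℕ) : ℝ) = d at *
    generalize ((i / m : ℕ) : ℝ) = c at *
    -- The orientation is (β - α) times this quantity, in which (d - c + γ)² dominates since |d - c|
    -- ≥ 1.
    have key : 0 < (d - c + γ) ^ 2 - 2 * γ ^ 2 + (α + β) * (d - c + γ) - α * β := by
      rcases hD with hD | hD
      · nlinarith [mul_nonneg hα0 hγ0, mul_nonneg hβ0 hγ0, mul_nonneg hα0 (sub_nonneg.2 hD),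
          mul_nonneg hβ0 (sub_nonneg.2 hD), mul_nonneg hγ0 (sub_nonneg.2 hD),
          mul_le_mul hα1 hβ1 hβ0 (by norm_num), mul_le_mul hγ1 hγ1 hγ0 (by norm_num)]
      · nlinarith [mul_nonneg hα0 hγ0, mul_nonneg hβ0 hγ0,
          mul_nonneg (sub_nonneg.2 hα1) (sub_nonneg.2 hD),
          mul_nonneg (sub_nonneg.2 hβ1) (sub_nonneg.2 hD),
          mul_nonneg (sub_nonneg.2 hγ1) (sub_nonneg.2 hD),
          mul_le_mul hα1 hβ1 hβ0 (by norm_num), mul_le_mul hγ1 hγ1 hγ0 (by norm_num)]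
    have := mul_pos (sub_pos.2 hαβ) key
    linarith
  · intro i j l hij hjl hk hk'
    have hαβ := hlt i j hij hk
    have hβγ := hlt j l hjl (hk.symm.trans hk'.symm)
    simp only [orient, clusterPoint, PiLp.toLp_apply, Matrix.cons_val_zero, Matrix.cons_val_one,
      ← hk, hk']
    generalize ((i % m : ℕ) : ℝ) / (8 * m) = α at *
    generalize ((j % m : ℕ) : ℝ) / (8 * m) = β at *
    generalize ((l % m : ℕ) : ℝ) / (8 * m) = γ at *
    -- Here the orientation is minus the Vandermonde product of the offsets.
    have := mul_pos (mul_pos (sub_pos.2 hαβ) (sub_pos.2 hβγ)) (sub_pos.2 (hαβ.trans hβγ))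
    linarith

-- The defining inequalities are strict and continuous in the points, so they hold on a product of
-- open sets around `clusterPoint`, inside which a generic drawing is chosen.
open Filter Topology in
theorem exists_concaveClusters {m : ℕ} (hm : 0 < m) (n : ℕ) :
    ∃ D : RectilinearDrawing (⊤ : SimpleGraph (Fin n)),
      ConcaveClusters (fun i : Fin n => (i / m : ℕ)) D.pos := by
  have hz := concaveClusters_clusterPoint hm n
  have hcont : ∀ i j l : Fin n, Continuous fun pos : Fin n → Plane =>
      orient (pos i) (pos j) (pos l) := by
    intro i j l
    unfold orient
    fun_prop
  have hev : ∀ᶠ pos in 𝓝 (clusterPoint m : Fin n → Plane),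
      ConcaveClusters (fun i : Fin n => (i / m : ℕ)) pos := by
    have h1 : ∀ᶠ pos in 𝓝 (clusterPoint m : Fin n → Plane), ∀ i j w : Fin n, i < j →
        (i / m : ℕ) = (j / m : ℕ) → (w / m : ℕ) ≠ (i / m : ℕ) →
        0 < orient (pos i) (pos j) (pos w) := by
      simp only [eventually_all]
      exact fun i j w h1 h2 h3 => (hcont i j w).continuousAt.eventually_const_lt
        (hz.outside i j w h1 h2 h3)
    have h2 : ∀ᶠ pos in 𝓝 (clusterPoint m : Fin n → Plane), ∀ i j l : Fin n, i < j → j < l →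
        (i / m : ℕ) = (j / m : ℕ) → (l / m : ℕ) = (i / m : ℕ) →
        orient (pos i) (pos j) (pos l) < 0 := by
      simp only [eventually_all]
      exact fun i j l h1 h2 h3 h4 => (hcont i j l).continuousAt.eventually_lt_const
        (hz.inside i j l h1 h2 h3 h4)
    filter_upwards [h1, h2] with pos a b using ⟨a, b⟩
  obtain ⟨O, hO, hOopen, hzO⟩ := eventually_nhds_iff.1 hev
  obtain ⟨U, hU, hUO⟩ := isOpen_pi_iff'.1 hOopen _ hzO
  obtain ⟨D, hD⟩ := exists_rectilinearDrawing (⊤ : SimpleGraph (Fin n)) U (fun v => (hU v).1)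
    (fun v => ⟨_, (hU v).2⟩)
  exact ⟨D, hO _ (hUO fun v _ => hD v)⟩

/-- The edges inside the cluster `κ`. -/
def clusterEdges {n : ℕ} (key : Fin n → ℕ) (κ : ℕ) : Finset (Sym2 (Fin n)) :=
  (Finset.univ.filter fun i => key i = κ).offDiag.image Sym2.mk.uncurry

theorem mem_clusterEdges {n : ℕ} {key : Fin n → ℕ} {κ : ℕ} {a b : Fin n} :
    s(a, b) ∈ clusterEdges key κ ↔ a ≠ b ∧ key a = κ ∧ key b = κ := by
  simp only [clusterEdges, Finset.mem_image, Finset.mem_offDiag, Finset.mem_filter,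
    Finset.mem_univ, true_and, Prod.exists, Function.uncurry_apply_pair]
  constructor
  · rintro ⟨u, v, ⟨hu, hv, huv⟩, h⟩
    rcases Sym2.eq_iff.1 h with ⟨rfl, rfl⟩ | ⟨rfl, rfl⟩
    · exact ⟨huv, hu, hv⟩
    · exact ⟨huv.symm, hv, hu⟩
  · rintro ⟨h1, h2, h3⟩
    exact ⟨a, b, ⟨h2, h3, h1⟩, rfl⟩

theorem disjoint_clusterEdges {n : ℕ} (key : Fin n → ℕ) {κ κ' : ℕ} (h : κ ≠ κ') :
    Disjoint (clusterEdges key κ) (clusterEdges key κ') := by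
  rw [Finset.disjoint_left]
  intro e he he'
  induction e with | _ a b
  exact h ((mem_clusterEdges.1 he).2.1.symm.trans (mem_clusterEdges.1 he').2.1)

/-- Each crossing is assigned an edge of the cluster through it; the assignment is injective because
two segments meet at most once. -/
theorem ConcaveClusters.encard_crossingsOn_le {n : ℕ} {key : Fin n → ℕ}
    {D : RectilinearDrawing (⊤ : SimpleGraph (Fin n))} (h : ConcaveClusters key D.pos) {κ : ℕ}
    {e : Sym2 (Fin n)} (he : e ∈ clusterEdges key κ) :
    (D.crossingsOn e).encard ≤ (clusterEdges key κ).card := by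
  induction e with | _ a b
  obtain ⟨hab, ha, hb⟩ := mem_clusterEdges.1 he
  have hex : ∀ p ∈ D.crossingsOn s(a, b), ∃ f ∈ clusterEdges key κ,
      p ∈ edgeInterior D.pos s(a, b) ∩ edgeInterior D.pos f ∧
      (edgeInterior D.pos s(a, b) ∩ edgeInterior D.pos f).Subsingleton := by
    rintro p ⟨hp, f, hf, hfe, hpf⟩
    induction f with | _ u w
    have huw : u ≠ w := hf
    obtain ⟨h1, h2, h3, h4⟩ := RectilinearDrawing.endpoints_ne D.general_position hab huw hfe.symm
      hp hpf
    obtain ⟨k1, k2⟩ := h.key_eq_of_crossing hab (ha.trans hb.symm) h1.symm h3.symm h2.symm h4.symm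
      hp hpf
    exact ⟨s(u, w), mem_clusterEdges.2 ⟨huw, k1.trans ha, k2.trans ha⟩, ⟨hp, hpf⟩,
      openSegment_inter_subsingleton (D.general_position a b u hab h1 h3)⟩
  have : Nonempty (Sym2 (Fin n)) := ⟨s(a, b)⟩
  choose! g hg1 hg2 hg3 using hex
  rw [← Set.encard_coe_eq_coe_finsetCard]
  refine Set.encard_le_encard_of_injOn (f := g) hg1 fun p hp q hq hpq => ?_
  exact hg3 p hp (hg2 p hp) (by rw [hpq]; exact hg2 q hq)

theorem card_cluster {n m κ : ℕ} (hm : 0 < m) (hκ : κ < n / m) :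
    (Finset.univ.filter fun i : Fin n => (i / m : ℕ) = κ).card = m := by
  have hle : (κ + 1) * m ≤ n := (Nat.mul_le_mul_right m hκ).trans (Nat.div_mul_le_self n m)
  rw [add_mul, one_mul] at hle
  rw [← Finset.card_map Fin.valEmbedding]
  have : (Finset.univ.filter fun i : Fin n => (i / m : ℕ) = κ).map Fin.valEmbedding =
      Finset.Ico (κ * m) (κ * m + m) := by
    ext x
    simp only [Finset.mem_map, Finset.mem_filter, Finset.mem_univ, true_and, Fin.valEmbedding_apply,
      Finset.mem_Ico]
    constructor
    · rintro ⟨i, hi, rfl⟩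
      have := (Nat.div_eq_iff hm).1 hi
      omega
    · intro hx
      exact ⟨⟨x, by omega⟩, (Nat.div_eq_iff hm).2 (by dsimp only; omega), rfl⟩
  rw [this]
  simp

theorem card_cluster_le {n m : ℕ} (hm : 0 < m) (κ : ℕ) :
    (Finset.univ.filter fun i : Fin n => (i / m : ℕ) = κ).card ≤ m := by
  have h : ((Finset.univ.filter fun i : Fin n => (i / m : ℕ) = κ).map Fin.valEmbedding) ⊆
      Finset.Ico (κ * m) (κ * m + m) := by
    intro x
    simp only [Finset.mem_map, Finset.mem_filter, Finset.mem_univ, true_and, Fin.valEmbedding_apply,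
      Finset.mem_Ico]
    rintro ⟨i, hi, rfl⟩
    have := (Nat.div_eq_iff hm).1 hi
    omega
  simpa using Finset.card_le_card h

/-- Some drawing of the complete graph has `⌊n / m⌋ * (m choose 2)` edges with at most `m choose 2`
crossings each. -/
theorem exists_le_crossingSum {n m k : ℕ} (hm : 0 < m) (hk : m.choose 2 ≤ k) :
    ∃ D : RectilinearDrawing (⊤ : SimpleGraph (Fin n)),
      n / m * m.choose 2 ≤ D.crossingSum k := by
  classical
  obtain ⟨D, hD⟩ := exists_concaveClusters hm n
  refine ⟨D, ?_⟩
  set key : Fin n → ℕ := fun i => (i / m : ℕ)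
  have hcard : ((Finset.range (n / m)).biUnion (clusterEdges key)).card =
      n / m * m.choose 2 := by
    rw [Finset.card_biUnion fun κ _ κ' _ h => disjoint_clusterEdges key h,
      Finset.sum_const_nat (m := m.choose 2), Finset.card_range]
    intro κ hκ
    rw [clusterEdges, Sym2.card_image_offDiag, card_cluster hm (Finset.mem_range.1 hκ)]
  rw [← hcard, ← Set.ncard_coe_finset]
  refine Set.ncard_le_ncard ?_ (Set.toFinite _)
  intro e he
  obtain ⟨κ, -, he⟩ := Finset.mem_biUnion.1 he
  refine ⟨?_, (hD.encard_crossingsOn_le he).trans ?_⟩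
  · induction e with | _ a b
    exact (mem_clusterEdges.1 he).1
  · rw [clusterEdges, Sym2.card_image_offDiag]
    exact_mod_cast (Nat.choose_le_choose 2 (card_cluster_le hm κ)).trans hk

/-! ### Existence of the maximum and the final bounds -/

/-- The supremum of an empty or unbounded set of naturals defaults to 0, so both the existence of a
drawing and a uniform bound are needed. -/
theorem isGreatest_maxCrossingSum {V : Type*} [Fintype V] (G : SimpleGraph V) (k : ℕ) :
    IsGreatest (Set.range fun D : RectilinearDrawing G => D.crossingSum k) (maxCrossingSum G k) := by
  classical
  have hbdd : BddAbove (Set.range fun D : RectilinearDrawing G => D.crossingSum k) := by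
    refine ⟨Fintype.card (Sym2 V), ?_⟩
    rintro _ ⟨D, rfl⟩
    exact (Set.ncard_le_card _).trans (by rw [Nat.card_eq_fintype_card])
  obtain ⟨D, -⟩ := exists_rectilinearDrawing G (fun _ => Set.univ) (fun _ => isOpen_univ)
    (fun _ => Set.univ_nonempty)
  exact ⟨Nat.sSup_mem ⟨_, D, rfl⟩ hbdd, fun x hx => le_csSup hbdd hx⟩

theorem le_maxCrossingSum {n k : ℕ} (hk : 1 ≤ k) (hkn : (k : ℝ) ≤ (((n : ℝ) - 2) / 2) ^ 2) :
    1 / 8 * ((n : ℝ) * √(k : ℝ)) ≤ (maxCrossingSum (⊤ : SimpleGraph (Fin n)) k : ℝ) := by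
  have hk' : (1 : ℝ) ≤ k := by exact_mod_cast hk
  -- For n = 0 the hypothesis still allows k = 1, because (n - 2)/2 is squared; the bound is then
  -- trivial.
  rcases Nat.lt_or_ge n 2 with hn | hn
  · interval_cases n
    · simp
    · norm_num at hkn
      linarith
  have hn' : (2 : ℝ) ≤ n := by exact_mod_cast hn
  set s := Nat.sqrt k
  have hs1 : 1 ≤ s := Nat.le_sqrt.2 (by simpa using hk)
  have hsk : s * s ≤ k := Nat.sqrt_le k
  have hks : √(k : ℝ) ≤ 2 * s := by
    have h1 : √(k : ℝ) ≤ s + 1 := by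
      rw [Real.sqrt_le_left (by positivity)]
      have := (Nat.lt_succ_sqrt k).le
      rw [sq]
      exact_mod_cast this
    have : (1 : ℝ) ≤ s := by exact_mod_cast hs1
    linarith
  have hsn : s + 1 ≤ n := by
    have h1 : (s : ℝ) ^ 2 ≤ (((n : ℝ) - 2) / 2) ^ 2 := by
      refine le_trans ?_ hkn
      rw [sq]
      exact_mod_cast hsk
    have h2 := le_of_sq_le_sq h1 (by linarith)
    have : (s : ℝ) + 1 ≤ n := by linarith
    exact_mod_cast this
  have hch : 2 * (s + 1).choose 2 = (s + 1) * s := by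
    rw [Nat.choose_two_right]
    have h2 : 2 ∣ (s + 1) * s := by
      rw [mul_comm]; exact (Nat.even_mul_succ_self s).two_dvd
    exact Nat.mul_div_cancel' h2
  -- Clusters of s + 1 points have s(s + 1)/2 ≤ s² ≤ k edges.
  obtain ⟨D, hD⟩ := exists_le_crossingSum (n := n) (m := s + 1) (k := k) (by omega) (by nlinarith)
  have hmax := (isGreatest_maxCrossingSum (⊤ : SimpleGraph (Fin n)) k).2 ⟨D, rfl⟩
  set M := maxCrossingSum (⊤ : SimpleGraph (Fin n)) k
  set r := n / (s + 1) with hr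
  have hr1 : 1 ≤ r := (Nat.one_le_div_iff (by omega)).2 hsn
  -- At least one cluster is full, so the fewer than s + 1 leftover points at most double the count.
  have hnr : n ≤ 2 * (r * (s + 1)) := by
    have h1 := Nat.div_add_mod n (s + 1)
    have h2 := Nat.mod_lt n (show s + 1 > 0 by omega)
    rw [← hr] at h1
    nlinarith
  have h1 : n * s ≤ 4 * M := by
    calc n * s ≤ 2 * (r * (s + 1)) * s := Nat.mul_le_mul_right s hnr
      _ = 4 * (r * (s + 1).choose 2) := by
        rw [show 4 * (r * (s + 1).choose 2) = 2 * r * (2 * (s + 1).choose 2) by ring, hch]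
        ring
      _ ≤ 4 * M := Nat.mul_le_mul_left 4 (hD.trans hmax)
  have h2 : (n : ℝ) * s ≤ 4 * M := by exact_mod_cast h1
  have h3 : (n : ℝ) * √(k : ℝ) ≤ n * (2 * s) := by gcongr
  linarith

theorem mainTheorem2 :
    ∃ c C : ℝ, 0 < c ∧ 0 < C ∧ ∀ n k : ℕ, 1 ≤ k → (k : ℝ) ≤ (((n : ℝ) - 2) / 2) ^ 2 →
      IsGreatest
        (Set.range fun D : RectilinearDrawing (⊤ : SimpleGraph (Fin n)) => D.crossingSum k)
        (maxCrossingSum (⊤ : SimpleGraph (Fin n)) k) ∧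
      c * ((n : ℝ) * √(k : ℝ)) ≤ (maxCrossingSum (⊤ : SimpleGraph (Fin n)) k : ℝ) ∧
      (maxCrossingSum (⊤ : SimpleGraph (Fin n)) k : ℝ) ≤ C * ((n : ℝ) * √(k : ℝ)) := by
  refine ⟨1 / 8, 24, by norm_num, by norm_num, fun n k hk hkn => ?_⟩
  have h := isGreatest_maxCrossingSum (⊤ : SimpleGraph (Fin n)) k
  refine ⟨h, le_maxCrossingSum hk hkn, ?_⟩
  obtain ⟨D, hD⟩ := h.1
  rw [← hD]
  simpa using D.crossingSum_le hk
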